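/- Let $F$ be a free group of finite rank, let $A \le F$ be a nontrivial free factor, and let $\phi : A \to F$ be an injective homomorphism. Definitions. For a group $G$, a \emph{subgroup system} of $G$ is either the trivial system $\{1\}$ or a nonempty finite set of nontrivial subgroups of $G$. A \emph{free factor system} of $G$ is either the trivial system $\{1\}$ or a nonempty finite set $\{A_1,\dots,A_l\}$ of nontrivial subgroups such that $G = A_1 * \cdots * A_l * B$ for some subgroup $B \le G$. A set $\mathcal A$ of subgroups of $G$ \emph{carries} a set $\mathcal B$ of subgroups of $G$ (in $G$) if for every $B \in \mathcal B$ there are $A' \in \mathcal A$ and $x \in G$ with $B \le xA'x^{-1}$; it carries a conjugacy class $[g]$ of $G$ if $g \in xA'x^{-1}$ for some $A' \in \mathcal A$ and $x \in G$. The relation "$\mathcal B$ is carried by $\mathcal A$ in $G$", written $\mathcal B \preceq \mathcal A$, is a preorder on free factor systems of $G$; systems with $\mathcal A \preceq \mathcal B \preceq \mathcal A$ are called equivalent. A subgroup system $\mathcal A$ of $A$ is \emph{$[\phi]$-invariant} if $\mathcal A$ carries $\{\phi(H) : H \in \mathcal A\}$ in $F$. A conjugacy class $[g]$ of $F$ always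 has $0$ forward iterates, with $\phi^0\cdot[g] = [g]$; it has $n+1$ forward iterates if it has $n$ forward iterates and $\phi^n\cdot[g]$ contains an element $a \in A$, in which case $\phi^{n+1}\cdot[g] = [\phi(a)]$ (this is well defined because $A$ is malnormal in $F$). Claim. There is a $[\phi]$-invariant free factor system $\mathcal F$ of $A$ that is maximal with respect to $\preceq$ (in $A$) among all $[\phi]$-invariant free factor systems of $A$, and every such maximal system is equivalent to $\mathcal F$ in $A$. Moreover, $\mathcal F$ carries in $F$ every conjugacy class of $F$ that has $2\cdot\mathrm{rank}(A)$ forward iterates, and $\mathcal F$ carries in $A$ every $[\phi]$-invariant subgroup system of $A$. -/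

import Mathlib

/-- The rank of a free group: the cardinality of a basis. -/
noncomputable def freeGroupRank (G : Type*) [Group G] [IsFreeGroup G] : ℕ :=
  Nat.card (IsFreeGroup.Generators G)

/-- `A` is a free factor of `G`: for some subgroup `B`, the canonical homomorphism
`A ∗ B → G` is an isomorphism. -/
def IsFreeFactor {G : Type*} [Group G] (A : Subgroup G) : Prop :=
  ∃ B : Subgroup G, Function.Bijective (Monoid.Coprod.lift A.subtype B.subtype)

/-- A subgroup system of `G`: the trivial system `{1}`, or a nonempty finite collection of
nontrivial subgroups. -/
def IsSubgroupSystem {G : Type*} [Group G] (𝒜 : Set (Subgroup G)) : Prop :=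
  𝒜 = {⊥} ∨ (𝒜.Nonempty ∧ 𝒜.Finite ∧ ∀ H ∈ 𝒜, H ≠ ⊥)

/-- A free factor system of `G`: the trivial system `{1}`, or a nonempty finite collection
`{A₁, …, A_l}` of nontrivial subgroups such that `G = A₁ ∗ ⋯ ∗ A_l ∗ B` for some subgroup `B`
(that is, the canonical homomorphism from this free product to `G` is an isomorphism). -/
def IsFreeFactorSystem {G : Type*} [Group G] (𝒜 : Set (Subgroup G)) : Prop :=
  𝒜 = {⊥} ∨ (𝒜.Nonempty ∧ 𝒜.Finite ∧ (∀ H ∈ 𝒜, H ≠ ⊥) ∧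
    ∃ B : Subgroup G, Function.Bijective
      (Monoid.Coprod.lift
        (Monoid.CoprodI.lift (fun H : 𝒜 => (H : Subgroup G).subtype)) B.subtype))

/-- `𝒜` carries `ℬ` (conjugation taking place in `G`): every `B ∈ ℬ` satisfies
`B ≤ x A x⁻¹` for some `A ∈ 𝒜` and some `x : G`. -/
def Carries {G : Type*} [Group G] (𝒜 ℬ : Set (Subgroup G)) : Prop :=
  ∀ B ∈ ℬ, ∃ A ∈ 𝒜, ∃ x : G, B ≤ A.map (MulAut.conj x).toMonoidHom

/-- `𝒜` carries the conjugacy class `c`: some element of `c` lies in a component of `𝒜`. -/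
def CarriesClass {G : Type*} [Group G] (𝒜 : Set (Subgroup G)) (c : ConjClasses G) : Prop :=
  ∃ H ∈ 𝒜, ∃ h ∈ H, ConjClasses.mk h = c

/-- A collection of subgroups of `A`, seen as a collection of subgroups of `F`. -/
def inAmbient {F : Type*} [Group F] {A : Subgroup F} (𝒜 : Set (Subgroup A)) :
    Set (Subgroup F) :=
  (fun H : Subgroup A => H.map A.subtype) '' 𝒜

/-- A collection `𝒜` of subgroups of `A` is `[φ]`-invariant, for `φ : A → F`, if `𝒜` carries
`φ(𝒜) = {φ(H) : H ∈ 𝒜}` in `F`. -/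
def IsInvariantSystem {F : Type*} [Group F] {A : Subgroup F} (φ : A →* F)
    (𝒜 : Set (Subgroup A)) : Prop :=
  Carries (inAmbient 𝒜) ((fun H : Subgroup A => H.map φ) '' 𝒜)

/-- `IsForwardIterate φ n c d` says that `d` is the `n`-th forward iterate `φⁿ · c` of the
conjugacy class `c`. If `φⁿ · c` contains an element `a` of `A`, then `φⁿ⁺¹ · c` is the class
of `φ a`. (When `A` is malnormal in `F`, such a `d` is determined by `n` and `c`.) -/
inductive IsForwardIterate {F : Type*} [Group F] {A : Subgroup F} (φ : A →* F) :
    ℕ → ConjClasses F → ConjClasses F → Prop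
  | zero (c : ConjClasses F) : IsForwardIterate φ 0 c c
  | succ (n : ℕ) (c : ConjClasses F) (a : A) :
      IsForwardIterate φ n c (ConjClasses.mk (a : F)) →
      IsForwardIterate φ (n + 1) c (ConjClasses.mk (φ a))

/-- The conjugacy class `c` has `n` forward iterates. -/
def HasForwardIterates {F : Type*} [Group F] {A : Subgroup F} (φ : A →* F) (n : ℕ)
    (c : ConjClasses F) : Prop :=
  ∃ d : ConjClasses F, IsForwardIterate φ n c d

/-- `𝒜` is maximal, for the preorder "is carried by" (conjugation in `A`), among the
`[φ]`-invariant free factor systems of `A`. -/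
def IsMaximalInvariantFreeFactorSystem {F : Type*} [Group F] {A : Subgroup F} (φ : A →* F)
    (𝒜 : Set (Subgroup A)) : Prop :=
  IsFreeFactorSystem 𝒜 ∧ IsInvariantSystem φ 𝒜 ∧
    ∀ ℬ : Set (Subgroup A), IsFreeFactorSystem ℬ → IsInvariantSystem φ ℬ →
      Carries ℬ 𝒜 → Carries 𝒜 ℬ

/-! The proof iterates a pullback along `φ`. Given a free factor system of `A`, the Kurosh theorem
applied to `φ(A)` shows that the nontrivial preimages of suitable conjugates of its members, one for
each double coset, again form a free factor system of `A` (`IsFreeFactorFamily.exists_pullback`).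
This pullback carries exactly those collections of nontrivial subgroups whose `φ`-image is carried
by the original system. Starting from `{A}`, iteration gives a descending chain `𝓢 n`, every term of
which carries every invariant system of nontrivial subgroups.

The complexity `∑ (2 rank H - 1)` strictly drops along the chain until two consecutive terms carry
each other (`IsProperFreeFactorSystem.complexity_lt_or_carries`). It starts at `2 rank A - 1`, so
this happens for some `n < 2 rank A`. Since `φ` maps `𝓢 (n + 1)` into `𝓢 n`, the system `𝓢 n` is
then invariant; as it carries all invariant systems, it is maximal and unique up to equivalence.
Going backwards along the iterates of a nontrivial class with `n + 1` iterates, each step raises the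
index by one, so the class lies in `𝓢 n`. -/

open Monoid

/-! ### Internal free products and free factor families -/

/-- `G` is the internal free product of the family `H` of subgroups: the family generates `G`, and
the inclusions `H i → ∗ᵢ H i` extend to `G`. -/
def IsFreeDecomposition {G : Type*} [Group G] {ι : Type*} (H : ι → Subgroup G) : Prop :=
  (⨆ i, H i) = ⊤ ∧ ∃ ψ : G →* CoprodI (fun i => H i), ∀ (i : ι) (h : H i),
    ψ h = CoprodI.of (M := fun i => H i) h

/-- A family `H` of subgroups with a common complement `B`: `G = (∗ᵢ H i) ∗ B`. -/
def IsFreeFactorFamily {G : Type*} [Group G] {ι : Type*} (H : ι → Subgroup G) : Prop :=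
  ∃ B : Subgroup G, IsFreeDecomposition (fun o : Option ι => o.elim B H)

theorem MonoidHom.eq_of_eqOn_iSup_eq_top {G M ι : Type*} [Group G] [Monoid M] {H : ι → Subgroup G}
    (hH : (⨆ i, H i) = ⊤) {f g : G →* M} (h : ∀ i, ∀ x ∈ H i, f x = g x) : f = g := by
  ext x
  have hx : x ∈ ⨆ i, H i := hH ▸ Subgroup.mem_top x
  exact Subgroup.iSup_induction H (C := fun x => f x = g x) hx h (by simp)
    fun x y hx hy => by simp [hx, hy]

/-- An external decomposition `(∗ᵢ M i) ∗ N ≃ G` gives an internal one by the images. -/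
theorem isFreeDecomposition_of_bijective {G ι N : Type*} [Group G] {M : ι → Type*}
    [∀ i, Group (M i)] [Group N] (f : ∀ i, M i →* G) (g : N →* G)
    (h : Function.Bijective (Coprod.lift (CoprodI.lift f) g)) :
    IsFreeDecomposition (fun o : Option ι => o.elim g.range (fun i => (f i).range)) := by
  set e := MulEquiv.ofBijective _ h with he
  let H : Option ι → Subgroup G := fun o => o.elim g.range (fun i => (f i).range)
  let α (i : ι) : M i →* CoprodI (fun o => H o) :=
    (CoprodI.of (M := fun o => H o) (i := some i)).comp (f i).rangeRestrict
  let β : N →* CoprodI (fun o => H o) :=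
    (CoprodI.of (M := fun o => H o) (i := none)).comp g.rangeRestrict
  refine ⟨?_, (Coprod.lift (CoprodI.lift α) β).comp e.symm.toMonoidHom, ?_⟩
  · rw [iSup_option_elim, sup_comm, ← CoprodI.range_eq_iSup, ← Coprod.range_lift]
    exact MonoidHom.range_eq_top.2 h.2
  · rintro (_ | i) ⟨_, ⟨x, rfl⟩⟩
    · have : e.symm (g x) = Coprod.inr x := by
        rw [MulEquiv.symm_apply_eq]; simp [he]
      change Coprod.lift (CoprodI.lift α) β (e.symm (g x)) = _
      rw [this, Coprod.lift_apply_inr]; rfl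
    · have : e.symm (f i x) = Coprod.inl (CoprodI.of x) := by
        rw [MulEquiv.symm_apply_eq]; simp [he]
      change Coprod.lift (CoprodI.lift α) β (e.symm (f i x)) = _
      rw [this, Coprod.lift_apply_inl, CoprodI.lift_of]; rfl

/-- The map `ψ` prescribed on the factors yields an inverse: one composite is checked on the factors
of the external product, the other on `G` because the factors generate it. -/
theorem isFreeDecomposition_option_iff {G ι : Type*} [Group G] (H : ι → Subgroup G)
    (B : Subgroup G) : IsFreeDecomposition (fun o : Option ι => o.elim B H) ↔
      Function.Bijective (Coprod.lift (CoprodI.lift (fun i => (H i).subtype)) B.subtype) := by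
  constructor
  · rintro ⟨hsup, ψ, hψ⟩
    let H' : Option ι → Subgroup G := fun o => o.elim B H
    let r (o : Option ι) : H' o →* Coprod (CoprodI fun i => H i) B :=
      match o with
      | none => Coprod.inr
      | some i => Coprod.inl.comp (CoprodI.of (M := fun i => H i))
    let ρ := (CoprodI.lift r).comp ψ
    have hB (b : B) : ρ b = Coprod.inr b := by
      exact (congrArg (CoprodI.lift r) (hψ none b)).trans (CoprodI.lift_of (i := none) r _)
    have hH (i : ι) (b : H i) : ρ b = Coprod.inl (CoprodI.of (M := fun i => H i) b) := by
      exact (congrArg (CoprodI.lift r) (hψ (some i) b)).trans (CoprodI.lift_of (i := some i) r _)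
    refine Function.bijective_iff_has_inverse.2 ⟨ρ, fun x => ?_, fun x => ?_⟩
    · refine DFunLike.congr_fun (f := ρ.comp (Coprod.lift _ _)) (g := MonoidHom.id _) ?_ x
      refine Coprod.hom_ext (CoprodI.ext_hom _ _ fun i => ?_) ?_
      · ext b; simp [hH]
      · ext b; simp [hB]
    · refine DFunLike.congr_fun (f := (Coprod.lift _ _).comp ρ) (g := MonoidHom.id _) ?_ x
      refine MonoidHom.eq_of_eqOn_iSup_eq_top hsup ?_
      rintro (_ | i) x hx
      · simpa using congrArg (Coprod.lift (CoprodI.lift (fun i => (H i).subtype)) B.subtype)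
          (hB ⟨x, hx⟩)
      · simpa using congrArg (Coprod.lift (CoprodI.lift (fun i => (H i).subtype)) B.subtype)
          (hH i ⟨x, hx⟩)
  · intro h
    simpa only [Subgroup.range_subtype] using isFreeDecomposition_of_bijective _ _ h

theorem isFreeFactorFamily_iff {G ι : Type*} [Group G] (H : ι → Subgroup G) :
    IsFreeFactorFamily H ↔ ∃ B : Subgroup G, Function.Bijective
      (Coprod.lift (CoprodI.lift (fun i => (H i).subtype)) B.subtype) :=
  exists_congr fun B => isFreeDecomposition_option_iff H B

/-- Amalgamating the factors of a free decomposition along a map of index sets. -/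
theorem IsFreeDecomposition.regroup {G ι κ : Type*} [Group G] {H : ι → Subgroup G}
    (hH : IsFreeDecomposition H) (f : ι → κ) :
    IsFreeDecomposition (fun k => ⨆ i : {i // f i = k}, H i) := by
  obtain ⟨hsup, ψ, hψ⟩ := hH
  let P : κ → Subgroup G := fun k => ⨆ i : {i // f i = k}, H i
  have hle (i : ι) : H i ≤ P (f i) := le_iSup (fun j : {j // f j = f i} => H j) ⟨i, rfl⟩
  let r (i : ι) : H i →* CoprodI (fun k => P k) :=
    (CoprodI.of (M := fun k => P k) (i := f i)).comp (Subgroup.inclusion (hle i))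
  refine ⟨?_, (CoprodI.lift r).comp ψ, fun k => ?_⟩
  · rw [eq_top_iff, ← hsup]
    exact iSup_le fun i => (hle i).trans (le_iSup P (f i))
  · rintro ⟨x, hx⟩
    induction hx using Subgroup.iSup_induction' with
    | hp i x hx =>
      obtain ⟨i, rfl⟩ := i
      change CoprodI.lift r (ψ x) = _
      rw [hψ i ⟨x, hx⟩, CoprodI.lift_of]; rfl
    | h1 => exact (map_one _).trans (map_one (CoprodI.of (M := fun k => P k) (i := k))).symm
    | hmul x y hx hy h1 h2 =>
      have h3 := congrArg₂ (· * ·) h1 h2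
      simp only [← map_mul] at h3
      exact h3

/-- The factors outside the image of `e` are absorbed into the complement. -/
theorem IsFreeFactorFamily.comp_injective {G ι κ : Type*} [Group G] {H : ι → Subgroup G}
    (hH : IsFreeFactorFamily H) {e : κ → ι} (he : Function.Injective e) :
    IsFreeFactorFamily (fun k => H (e k)) := by
  classical
  obtain ⟨B, hB⟩ := hH
  let f : Option ι → Option κ := fun o => o.bind (Function.partialInv e)
  have h := hB.regroup f
  refine ⟨⨆ i : {i // f i = none}, (i : Option ι).elim B H, ?_⟩
  convert h using 2 with o
  cases o with
  | none => rfl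
  | some k =>
    refine le_antisymm ?_ (iSup_le ?_)
    · exact le_iSup (fun i : {i // f i = some k} => (i : Option ι).elim B H)
        ⟨some (e k), Function.partialInv_left he k⟩
    · rintro ⟨_ | i, hi⟩
      · simp [f] at hi
      · have : e k = i := (he.isPartialInv k i).1 hi
        simp [this]

theorem IsFreeFactorFamily.map_mulEquiv {G G' ι : Type*} [Group G] [Group G']
    {H : ι → Subgroup G} (hH : IsFreeFactorFamily H) (e : G ≃* G') :
    IsFreeFactorFamily (fun i => (H i).map e.toMonoidHom) := by
  obtain ⟨B, hB⟩ := (isFreeFactorFamily_iff H).1 hH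
  have h := isFreeDecomposition_of_bijective (fun i => e.toMonoidHom.comp (H i).subtype)
    (e.toMonoidHom.comp B.subtype) (by
      convert e.bijective.comp hB
      rw [← MulEquiv.coe_toMonoidHom, ← MonoidHom.coe_comp, DFunLike.coe_fn_eq]
      exact Coprod.hom_ext (CoprodI.ext_hom _ _ fun i => by ext; simp) (by ext; simp))
  simp only [MonoidHom.range_comp, Subgroup.range_subtype] at h
  exact ⟨_, h⟩

/-- A free factor family of a free factor is a free factor family of the ambient group. -/
theorem IsFreeFactorFamily.map_subtype {G ι : Type*} [Group G] {A : Subgroup G}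
    (hA : IsFreeFactor A) {H : ι → Subgroup A} (hH : IsFreeFactorFamily H) :
    IsFreeFactorFamily (fun i => (H i).map A.subtype) := by
  obtain ⟨C, hC⟩ := hA
  obtain ⟨B, hB⟩ := (isFreeFactorFamily_iff H).1 hH
  let E : Coprod (CoprodI fun i => H i) (Coprod B C) ≃* G :=
    (MulEquiv.coprodAssoc _ _ _).symm.trans
      ((MulEquiv.coprodCongr (MulEquiv.ofBijective _ hB) (MulEquiv.refl C)).trans
        (MulEquiv.ofBijective _ hC))
  have h := isFreeDecomposition_of_bijective (fun i => A.subtype.comp (H i).subtype)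
    (Coprod.lift (A.subtype.comp B.subtype) C.subtype) (by
      convert E.bijective
      rw [← MulEquiv.coe_toMonoidHom, DFunLike.coe_fn_eq]
      refine Coprod.hom_ext (CoprodI.ext_hom _ _ fun i => ?_) (Coprod.hom_ext ?_ ?_) <;>
        ext <;> simp [E])
  simp only [MonoidHom.range_comp, Subgroup.range_subtype] at h
  exact ⟨_, h⟩

/-! ### The Kurosh subgroup theorem -/

theorem exists_list_prod_of_iSup_eq_top {G ι : Type*} [Group G] {H : ι → Subgroup G}
    (hH : (⨆ i, H i) = ⊤) (x : G) : ∃ l : List G, (∀ g ∈ l, ∃ i, g ∈ H i) ∧ l.prod = x := by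
  have hx : x ∈ ⨆ i, H i := hH ▸ Subgroup.mem_top x
  refine Subgroup.iSup_induction H (C := fun x => ∃ l : List G, (∀ g ∈ l, ∃ i, g ∈ H i) ∧
    l.prod = x) hx (fun i x hx => ⟨[x], by simpa using ⟨i, hx⟩, by simp⟩) ⟨[], by simp, rfl⟩ ?_
  rintro _ _ ⟨l, hl, rfl⟩ ⟨m, hm, rfl⟩
  exact ⟨l ++ m, fun g hg => (List.mem_append.1 hg).elim (hl g) (hm g), List.prod_append⟩

/-- For a transitive action of a group generated by subgroups `H j`, the distance to a base point
in the graph whose edges are the pairs of points in a common `H j`-orbit. -/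
theorem exists_depth {F J S : Type*} [Group F] [MulAction F S] {H : J → Subgroup F}
    (hH : (⨆ j, H j) = ⊤) (s₀ : S) (hs₀ : ∀ s : S, ∃ x : F, x • s₀ = s) :
    ∃ d : S → ℕ, ∀ s, s ≠ s₀ → ∃ j, ∃ h ∈ H j, d (h • s) < d s := by
  classical
  have hex (s : S) : ∃ n : ℕ, ∃ l : List F, (∀ g ∈ l, ∃ i, g ∈ H i) ∧ l.length = n ∧
      l.prod • s₀ = s := by
    obtain ⟨x, rfl⟩ := hs₀ s
    obtain ⟨l, hl, rfl⟩ := exists_list_prod_of_iSup_eq_top hH x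
    exact ⟨l.length, l, hl, rfl, rfl⟩
  refine ⟨fun s => Nat.find (hex s), fun s hs => ?_⟩
  obtain ⟨l, hl, hn, hp⟩ := Nat.find_spec (hex s)
  cases l with
  | nil => exact absurd (by simpa using hp.symm) hs
  | cons g l =>
    obtain ⟨j, hj⟩ := hl g (by simp)
    refine ⟨j, g⁻¹, inv_mem hj, ?_⟩
    change Nat.find (hex (g⁻¹ • s)) < Nat.find (hex s)
    have hle : Nat.find (hex (g⁻¹ • s)) ≤ l.length := Nat.find_min' _
      ⟨l, fun x hx => hl x (List.mem_cons_of_mem _ hx), rfl, by rw [← hp]; simp [mul_smul]⟩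
    rw [← hn, List.length_cons]; omega

/-- Base points of the orbits of the subgroups `H j`, of minimal depth. -/
theorem exists_orbit_basePoints {F J S : Type*} [Group F] [MulAction F S] (H : J → Subgroup F)
    (d : S → ℕ) : ∃ (pt : J → S → S) (a : J → S → F),
      (∀ j s, a j s ∈ H j) ∧ (∀ j s, a j s • pt j s = s) ∧ (∀ j s, pt j s = s → a j s = 1) ∧
      (∀ j s, ∀ h ∈ H j, pt j (h • s) = pt j s) ∧ (∀ j s, ∀ h ∈ H j, d (pt j s) ≤ d (h • s)) := by
  classical
  let O (j : J) (s : S) : Set S := MulAction.orbit (H j) s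
  have hO (j : J) (s : S) : (O j s).Nonempty := ⟨s, MulAction.mem_orbit_self s⟩
  let pt (j : J) (s : S) : S := Function.argminOn d (O j s) (hO j s)
  have hpt (j : J) (s : S) : ∃ h ∈ H j, h • pt j s = s := by
    obtain ⟨⟨h, hh⟩, hx⟩ : pt j s ∈ O j s := Function.argminOn_mem d _ (hO j s)
    exact ⟨h⁻¹, inv_mem hh, by rw [← hx]; exact inv_smul_smul h s⟩
  choose b hb hbs using hpt
  -- The forced value 1 at base points makes the edge joining an orbit to its base point trivial in
  -- the cocycle used later.
  refine ⟨pt, fun j s => if pt j s = s then 1 else b j s, fun j s => ?_, fun j s => ?_,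
    fun j s h => if_pos h, fun j s h hh => ?_, fun j s h hh => ?_⟩
  · dsimp only; split_ifs
    exacts [one_mem _, hb j s]
  · dsimp only; split_ifs with h
    exacts [by rw [one_smul, h], hbs j s]
  · have : O j (h • s) = O j s := MulAction.orbit_smul (⟨h, hh⟩ : H j) s
    simp only [pt, this]
  · exact Function.argminOn_le d (O j s) ⟨⟨h, hh⟩, rfl⟩

/-- `γ s` is the product of the labels `b` along the chain of parents from `s` to `s₀`, which ends
because the depth drops. -/
theorem exists_transversal_of_parent {F S : Type*} [Group F] (s₀ : S) (d : S → ℕ) (q : S → S)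
    (b : S → F) (hq : ∀ s, s ≠ s₀ → d (q s) < d s) :
    ∃ γ : S → F, γ s₀ = 1 ∧ ∀ s, s ≠ s₀ → γ s = b s * γ (q s) := by
  classical
  let wf : WellFounded (fun s t : S => d s < d t) := InvImage.wf d wellFounded_lt
  let step (s : S) (r : ∀ t, d t < d s → F) : F :=
    if h : s = s₀ then 1 else b s * r (q s) (hq s h)
  refine ⟨wf.fix step, ?_, fun s hs => ?_⟩
  · rw [wf.fix_eq]; simp [step]
  · rw [wf.fix_eq]; simp [step, hs]

/-- **Kurosh subgroup theorem.** If `F` is the free product of the subgroups `H j`, then every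
subgroup `K` has a free factor family consisting of the intersections of `K` with conjugates of
the `H j`, one for each double coset in `K \ F / H j`. -/
theorem IsFreeDecomposition.kurosh {F : Type*} [Group F] {J : Type*} [Nonempty J]
    {H : J → Subgroup F} (hH : IsFreeDecomposition H) (K : Subgroup F) :
    ∃ (I : Set (J × F ⧸ K)) (γ : I → F),
      IsFreeFactorFamily (fun i : I =>
        ((H i.1.1).map (MulAut.conj (γ i)).toMonoidHom).subgroupOf K) ∧
      ∀ (j : J) (x : F), ∃ i : I, i.1.1 = j ∧ ∃ y ∈ K, ∃ h ∈ H j, x = y * γ i * h := by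
  classical
  obtain ⟨hsup, Ψ, hΨ⟩ := hH
  -- A covering-space argument in algebraic form. In the bipartite graph of cosets `s` and `H
  -- j`-orbits, the pair `(j, s)` is the edge from `s` to its orbit. With stabilizers as vertex
  -- groups, `K` should be the free product of these groups and the free group on the edges outside
  -- a maximal tree. To prove it, `F` is made to act on `S` times this product, and the inverse map
  -- is read off from the action of `K` on `(s₀, 1)`.
  let S := F ⧸ K
  let s₀ : S := ((1 : F) : F ⧸ K)
  obtain ⟨d, hd⟩ := exists_depth (S := S) hsup s₀ fun s => by
    induction s using QuotientGroup.induction_on with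
    | H z => exact ⟨z, by
        change ((z * 1 : F) : F ⧸ K) = _
        rw [mul_one]⟩
  obtain ⟨pt, a, haH, hapt, ha1, hptsmul, hptmin⟩ := exists_orbit_basePoints (S := S) H d
  have hptpt (j : J) (s : S) : pt j (pt j s) = pt j s := by
    conv_rhs => rw [← hapt j s, hptsmul j _ _ (haH j s)]
  -- `c s` labels the edge of the tree leading from `s` towards `s₀`: the base point of that orbit
  -- is strictly less deep.
  have hc (s : S) : ∃ j, s ≠ s₀ → d (pt j s) < d s := by
    by_cases hs : s = s₀
    · exact ⟨Classical.arbitrary J, fun h => absurd hs h⟩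
    · obtain ⟨j, h, hh, hlt⟩ := hd s hs
      exact ⟨j, fun _ => (hptmin j s h hh).trans_lt hlt⟩
  choose c hc using hc
  obtain ⟨γ, hγ0, hγ⟩ := exists_transversal_of_parent s₀ d (fun s => pt (c s) s)
    (fun s => a (c s) s) hc
  have hγs (s : S) : γ s • s₀ = s := by
    induction hn : d s using Nat.strong_induction_on generalizing s with
    | _ n ih =>
      by_cases hs : s = s₀
      · rw [hs, hγ0, one_smul]
      · rw [hγ s hs, mul_smul, ih _ (hn ▸ hc s hs) _ rfl, hapt]
  have hmemK (x : F) : x • s₀ = s₀ ↔ x ∈ K := by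
    rw [← MulAction.mem_stabilizer_iff, MulAction.stabilizer_quotient]
  -- the tree, the vertex groups, and their free product with a free group
  let tree (j : J) (s : S) : Prop := pt j s = s ∨ (s ≠ s₀ ∧ c s = j)
  let St (j : J) (s : S) : Subgroup F := H j ⊓ MulAction.stabilizer F s
  let I : Set (J × S) := {q | pt q.1 q.2 = q.2}
  let Ed : Set (J × S) := {q | ¬ tree q.1 q.2}
  let M (i : I) : Subgroup F := St i.1.1 i.1.2
  -- The value 1 off the domain is a default that keeps dependent types out of the cocycle; for `e`
  -- below, the value 1 on tree edges is genuine and collapses the tree.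
  let ofL (j : J) (s : S) (g : F) :
      Coprod (CoprodI fun i => M i) (FreeGroup Ed) :=
    if h : pt j s = s ∧ g ∈ St j s then
      Coprod.inl (CoprodI.of (M := fun i => M i) (i := ⟨(j, s), h.1⟩) ⟨g, h.2⟩)
    else 1
  let e (j : J) (s : S) : Coprod (CoprodI fun i => M i) (FreeGroup Ed) :=
    if h : tree j s then 1 else Coprod.inr (FreeGroup.of ⟨(j, s), h⟩)
  have ofL_mul (j : J) (s : S) (g g' : F) (hs : pt j s = s) (hg : g ∈ St j s)
      (hg' : g' ∈ St j s) : ofL j s (g * g') = ofL j s g * ofL j s g' := by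
    simp only [ofL]
    rw [dif_pos ⟨hs, mul_mem hg hg'⟩, dif_pos ⟨hs, hg⟩, dif_pos ⟨hs, hg'⟩, ← map_mul, ← map_mul]
    rfl
  have ofL_one (j : J) (s : S) : ofL j s 1 = 1 := by
    simp only [ofL]
    split_ifs with h
    · exact (congrArg _ (map_one _)).trans (map_one _)
    · rfl
  have e_pt (j : J) (s : S) (hs : pt j s = s) : e j s = 1 := dif_pos (Or.inl hs)
  have e_parent (s : S) (hs : s ≠ s₀) : e (c s) s = 1 := dif_pos (Or.inr ⟨hs, rfl⟩)
  -- the cocycle and the action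
  let σ (j : J) (h : F) (s : S) : F := (a j (h • s))⁻¹ * h * a j s
  -- `σ` is a loop: from the base point to `s`, along `h`, and back to the base point of the same
  -- orbit.
  have hσ (j : J) (h : F) (hh : h ∈ H j) (s : S) : σ j h s ∈ St j (pt j s) := by
    refine Subgroup.mem_inf.2
      ⟨mul_mem (mul_mem (inv_mem (haH _ _)) hh) (haH _ _), ?_⟩
    rw [MulAction.mem_stabilizer_iff]
    simp only [σ]
    rw [mul_smul, mul_smul, hapt, inv_smul_eq_iff]
    conv_lhs => rw [← hapt j (h • s)]
    rw [hptsmul j s h hh]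
  let act (j : J) : H j →* Function.End (S × Coprod (CoprodI fun i => M i) (FreeGroup Ed)) :=
    { toFun := fun h q => ((h : F) • q.1, e j ((h : F) • q.1) * ofL j (pt j q.1) (σ j h q.1) *
        (e j q.1)⁻¹ * q.2)
      map_one' := by
        funext ⟨s, l⟩
        change (_, _) = (_, _)
        simp [σ, ofL_one]
      map_mul' := fun h h' => by
        funext ⟨s, l⟩
        have h1 : σ j (h * h') s = σ j h ((h' : F) • s) * σ j h' s := by
          simp only [σ, mul_smul]; group
        have h2 := hσ j h h.2 ((h' : F) • s)
        rw [hptsmul j s h' h'.2] at h2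
        change (_, _) = (_, _)
        simp only [Subgroup.coe_mul, hptsmul j s h' h'.2, h1,
          ofL_mul j _ _ _ (hptpt j s) h2 (hσ j h' h'.2 s), mul_smul]
        refine Prod.ext rfl ?_
        simp only; group }
  let Act : F →* Function.End (S × Coprod (CoprodI fun i => M i) (FreeGroup Ed)) :=
    (CoprodI.lift act).comp Ψ
  have Act_of (j : J) (h : F) (hh : h ∈ H j) (s : S) (l : _) :
      Act h (s, l) =
      (h • s, e j (h • s) * ofL j (pt j s) (σ j h s) * (e j s)⁻¹ * l) := by
    have : Act h = act j ⟨h, hh⟩ := by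
      exact (congrArg (CoprodI.lift act) (hΨ j ⟨h, hh⟩)).trans (CoprodI.lift_of act _)
    rw [this]; rfl
  have Act_mul (x y : F) (q : _) : Act (x * y) q = Act x (Act y q) := by
    rw [map_mul]; rfl
  have Act_one (q : _) : Act 1 q = q := by rw [map_one]; rfl
  have Act_smul (x : F) (s : S) (l : _) : Act x (s, l) = (x • s, (Act x (s, 1)).2 * l) := by
    have hx : x ∈ ⨆ j, H j := hsup ▸ Subgroup.mem_top x
    revert s l
    refine Subgroup.iSup_induction H (C := fun x => ∀ s l, Act x (s, l) =
      (x • s, (Act x (s, 1)).2 * l)) hx ?_ ?_ ?_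
    · intro j h hh s l
      rw [Act_of j h hh, Act_of j h hh]; simp
    · intro s l; simp only [Act_one]; simp
    · intro x y hx hy s l
      rw [Act_mul, Act_mul, hy s l, hx, hy s 1, hx (y • s) ((Act y (s, 1)).2 * 1)]
      simp [mul_smul, mul_assoc]
  -- the homomorphism from the free product to `K`
  let f (i : I) : M i →* K :=
    ((MulAut.conj (γ i.1.2)⁻¹).toMonoidHom.comp (M i).subtype).codRestrict K (by
      rintro ⟨x, hx⟩
      rw [← hmemK]
      have h2 : x • i.1.2 = i.1.2 := hx.2
      simp [mul_smul, hγs, h2, inv_smul_eq_iff])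
  have hedge (j : J) (s : S) : (γ s)⁻¹ * a j s * γ (pt j s) ∈ K := by
    rw [← hmemK]; simp [mul_smul, hγs, hapt, inv_smul_eq_iff]
  let g : FreeGroup Ed →* K := FreeGroup.lift fun q =>
    ⟨(γ q.1.2)⁻¹ * a q.1.1 q.1.2 * γ (pt q.1.1 q.1.2), hedge _ _⟩
  let π : Coprod (CoprodI fun i => M i) (FreeGroup Ed) →* K := Coprod.lift (CoprodI.lift f) g
  have π_e (j : J) (s : S) : (π (e j s) : F) = (γ s)⁻¹ * a j s * γ (pt j s) := by
    by_cases h : tree j s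
    · have : e j s = 1 := dif_pos h
      rw [this, map_one]
      rcases h with h | ⟨hs, rfl⟩
      · rw [h, ha1 j s h]; simp
      · rw [mul_assoc, ← hγ s hs]; simp
    · have : e j s = Coprod.inr (FreeGroup.of ⟨(j, s), h⟩) := dif_neg h
      rw [this]
      simp [π, g]
  have π_ofL (j : J) (s : S) (x : F) (hs : pt j s = s) (hx : x ∈ St j s) :
      (π (ofL j s x) : F) = (γ s)⁻¹ * x * γ s := by
    simp only [ofL]
    rw [dif_pos ⟨hs, hx⟩]
    simp [π, f]
  -- The map `(s, l) ↦ γ s * π l` is `F`-equivariant; at `(s₀, 1)` this makes `π` a left inverse of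
  -- `ψ`.
  have π_Act (x : F) (s : S) (l : _) :
      γ (x • s) * π (Act x (s, l)).2 = x * (γ s * π l) := by
    have hx : x ∈ ⨆ j, H j := hsup ▸ Subgroup.mem_top x
    revert s l
    refine Subgroup.iSup_induction H (C := fun x => ∀ s l,
      γ (x • s) * π (Act x (s, l)).2 = x * (γ s * π l)) hx ?_ ?_ ?_
    · intro j h hh s l
      rw [Act_of j h hh]
      simp only [map_mul, map_inv, Subgroup.coe_mul, Subgroup.coe_inv, π_e,
        π_ofL j _ _ (hptpt j s) (hσ j h hh s), hptsmul j s h hh, σ]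
      group
    · intro s l; simp [Act_one]
    · intro x y hx hy s l
      rw [Act_mul, Act_smul y, mul_smul, hx, mul_assoc, ← hy s l, Act_smul y s l]
  -- `γ s` runs along tree edges only, where the cocycle is trivial.
  have Act_γ (s : S) (l : _) : Act (γ s) (s₀, l) = (s, l) := by
    suffices h : Act (γ s) (s₀, 1) = (s, 1) by rw [Act_smul, h, hγs, one_mul]
    induction hn : d s using Nat.strong_induction_on generalizing s with
    | _ n ih =>
      by_cases hs : s = s₀
      · rw [hs, hγ0, Act_one]
      · rw [hγ s hs, Act_mul, ih _ (hn ▸ hc s hs) _ rfl, Act_of (c s) _ (haH _ _), hapt,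
          e_parent s hs, e_pt _ _ (hptpt _ _)]
        simp [σ, hapt, ha1 _ _ (hptpt _ _), ofL_one]
  have Act_γ_inv (s : S) (l : _) : Act (γ s)⁻¹ (s, l) = (s₀, l) := by
    rw [← Act_γ s l, ← Act_mul, inv_mul_cancel, Act_one]
  -- Multiplicativity holds because `K` fixes `s₀`, so the cocycle restricted to `K` at `s₀` is a
  -- homomorphism.
  let ψ : K →* Coprod (CoprodI fun i => M i) (FreeGroup Ed) := MonoidHom.mk'
    (fun k => (Act k (s₀, 1)).2) fun k k' => by
    rw [Subgroup.coe_mul, Act_mul, Act_smul k' s₀ 1, (hmemK k').2 k'.2, Act_smul k s₀]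
  have hπψ (k : K) : π (ψ k) = k := by
    have := π_Act k s₀ 1
    rw [(hmemK k).2 k.2, hγ0] at this
    exact Subtype.ext (by simpa [ψ] using this)
  have hψπ : ψ.comp π = MonoidHom.id _ := by
    refine Coprod.hom_ext (CoprodI.ext_hom _ _ ?_) (FreeGroup.ext_hom _ _ ?_)
    · rintro ⟨⟨j, s⟩, hs⟩
      ext ⟨x, hx⟩
      have hs' : pt j s = s := hs
      have hxs : x • s = s := hx.2
      have h1 : (Act ((γ s)⁻¹ * x * γ s) (s₀, 1)).2 = ofL j s x := by
        rw [Act_mul, Act_γ, Act_mul, Act_of j x hx.1, hxs, Act_γ_inv, e_pt j s hs']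
        simp [σ, hxs, hs', ha1 j s hs']
      have h2 : ofL j s x = Coprod.inl (CoprodI.of (M := fun i => M i)
          (i := ⟨(j, s), hs⟩) ⟨x, hx⟩) := dif_pos ⟨hs', hx⟩
      rw [h2] at h1
      simpa [ψ, π, f] using h1
    · rintro ⟨⟨j, s⟩, hq⟩
      have h1 : (Act ((γ s)⁻¹ * a j s * γ (pt j s)) (s₀, 1)).2 = e j s := by
        rw [Act_mul, Act_γ, Act_mul, Act_of j _ (haH j s), hapt, Act_γ_inv, e_pt j _ (hptpt j s)]
        simp [σ, hapt, hptpt, ha1 j _ (hptpt j s), ofL_one]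
      have h2 : e j s = Coprod.inr (FreeGroup.of ⟨(j, s), hq⟩) := dif_neg hq
      rw [h2] at h1
      simpa [ψ, π, g] using h1
  have hbij : Function.Bijective π :=
    Function.bijective_iff_has_inverse.2 ⟨ψ, fun l => DFunLike.congr_fun hψπ l, hπψ⟩
  -- Orbits of `H j` on `F ⧸ K` are double cosets in `H j \ F / K`; inversion turns them into those
  -- of `K \ F / H j`.
  refine ⟨I, fun i => (γ i.1.2)⁻¹, ?_, fun j x => ?_⟩
  · refine ⟨g.range, ?_⟩
    convert isFreeDecomposition_of_bijective f g hbij using 4 with o i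
    ext ⟨k, hk⟩
    rw [Subgroup.mem_subgroupOf, MonoidHom.mem_range]
    constructor
    · rintro ⟨x, hx, hxk⟩
      refine ⟨⟨x, hx, ?_⟩, Subtype.ext hxk⟩
      have hxk' : (γ i.1.2)⁻¹ * x * γ i.1.2 = k := by simpa using hxk
      have h3 := (hmemK k).2 hk
      rw [← hxk', mul_smul, mul_smul, hγs, inv_smul_eq_iff, hγs] at h3
      exact h3
    · rintro ⟨⟨x, hx⟩, hxk⟩
      exact ⟨x, hx.1, congrArg Subtype.val hxk⟩
  · let s : S := x⁻¹ • s₀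
    refine ⟨⟨(j, pt j s), hptpt j s⟩, rfl, x * a j s * γ (pt j s), ?_, (a j s)⁻¹,
      inv_mem (haH j s), by simp⟩
    rw [← hmemK, mul_smul, mul_smul, hγs, hapt]
    simp [s]

/-! ### Rank through rational characters -/

/-- The rank of a group, as the dimension of its space of rational characters. -/
noncomputable def charRank (G : Type*) [Group G] : ℕ :=
  Module.finrank ℚ (Additive G →+ ℚ)

/-- Restriction of rational characters along a homomorphism. -/
def charComp {G H : Type*} [Group G] [Group H] (f : H →* G) :
    (Additive G →+ ℚ) →ₗ[ℚ] (Additive H →+ ℚ) where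
  toFun χ := χ.comp f.toAdditive
  map_add' _ _ := rfl
  map_smul' _ _ := rfl

theorem charRank_congr {G H : Type*} [Group G] [Group H] (e : H ≃* G) :
    charRank H = charRank G := by
  refine (LinearEquiv.finrank_eq (LinearEquiv.ofLinearMap (charComp e.toMonoidHom)
    (charComp e.symm.toMonoidHom) ?_ ?_)).symm
  · ext χ x; exact congrArg χ (e.symm_apply_apply x)
  · ext χ x; exact congrArg χ (e.apply_symm_apply x)

/-- A homomorphism from a free product is an arbitrary family of homomorphisms on the factors. This
makes the rank additive without choosing bases. -/
theorem IsFreeDecomposition.bijective_charComp {G ι : Type*} [Group G] {H : ι → Subgroup G}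
    (hH : IsFreeDecomposition H) :
    Function.Bijective (LinearMap.pi fun i => charComp (H i).subtype) := by
  obtain ⟨hsup, ψ, hψ⟩ := hH
  constructor
  · intro χ χ' h
    apply (MonoidHom.toAdditiveLeft).symm.injective
    refine MonoidHom.eq_of_eqOn_iSup_eq_top hsup fun i x hx => ?_
    exact DFunLike.congr_fun (congrFun h i) (Additive.ofMul (⟨x, hx⟩ : H i))
  · intro χ
    let Θ : CoprodI (fun i => H i) →* Multiplicative ℚ :=
      CoprodI.lift fun i => MonoidHom.toAdditiveLeft.symm (χ i)
    refine ⟨MonoidHom.toAdditiveLeft (Θ.comp ψ), funext fun i => AddMonoidHom.ext fun x => ?_⟩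
    exact congrArg Multiplicative.toAdd
      ((congrArg Θ (hψ i x.toMul)).trans (CoprodI.lift_of (M := fun i => H i) _ x.toMul))

theorem IsFreeDecomposition.finite_char {G ι : Type*} [Group G] {H : ι → Subgroup G}
    (hH : IsFreeDecomposition H) [Module.Finite ℚ (Additive G →+ ℚ)] (i : ι) :
    Module.Finite ℚ (Additive (H i) →+ ℚ) := by
  classical
  refine Module.Finite.of_surjective (charComp (H i).subtype) fun χ => ?_
  obtain ⟨χ', h⟩ := hH.bijective_charComp.2 (Pi.single i χ)
  exact ⟨χ', by simpa using congrFun h i⟩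

theorem IsFreeDecomposition.charRank_eq {G ι : Type*} [Group G] [Fintype ι] {H : ι → Subgroup G}
    (hH : IsFreeDecomposition H) [Module.Finite ℚ (Additive G →+ ℚ)] :
    charRank G = ∑ i, charRank (H i) := by
  have := hH.finite_char
  rw [charRank, LinearEquiv.finrank_eq (LinearEquiv.ofBijective _ hH.bijective_charComp),
    Module.finrank_pi_fintype]
  rfl

theorem IsFreeDecomposition.charRank_eq_add {G ι : Type*} [Group G] [Fintype ι]
    {H : ι → Subgroup G} {B : Subgroup G}
    (hH : IsFreeDecomposition (fun o : Option ι => o.elim B H))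
    [Module.Finite ℚ (Additive G →+ ℚ)] : charRank G = charRank B + ∑ i, charRank (H i) :=
  hH.charRank_eq.trans (Fintype.sum_option _)

section FreeGroups

variable {G : Type*} [Group G] [IsFreeGroup G]

/-- A character of a free group is determined by its values on a basis. -/
noncomputable def charEquiv (G : Type*) [Group G] [IsFreeGroup G] :
    (Additive G →+ ℚ) ≃ₗ[ℚ] (IsFreeGroup.Generators G → ℚ) :=
  LinearEquiv.ofBijective
    { toFun := fun χ x => χ (Additive.ofMul (IsFreeGroup.of x))
      map_add' := fun _ _ => rfl
      map_smul' := fun _ _ => rfl } (by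
    constructor
    · intro χ χ' h
      apply (MonoidHom.toAdditiveLeft).symm.injective
      exact IsFreeGroup.ext_hom fun x => congrFun h x
    · intro v
      refine ⟨MonoidHom.toAdditiveLeft (IsFreeGroup.lift fun x => Multiplicative.ofAdd (v x)), ?_⟩
      funext x
      exact congrArg Multiplicative.toAdd (IsFreeGroup.lift_of (H := Multiplicative ℚ) _ x))

theorem finite_char_of_finite_generators [Finite (IsFreeGroup.Generators G)] :
    Module.Finite ℚ (Additive G →+ ℚ) :=
  Module.Finite.equiv (charEquiv G).symm

/-- The indicator functions of the basis elements are linearly independent. -/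
theorem finite_generators_of_finite_char [Module.Finite ℚ (Additive G →+ ℚ)] :
    Finite (IsFreeGroup.Generators G) := by
  classical
  have := Module.Finite.equiv (charEquiv G)
  exact (Pi.linearIndependent_single_one (IsFreeGroup.Generators G) ℚ).finite_of_isNoetherian

theorem charRank_eq_freeGroupRank [Module.Finite ℚ (Additive G →+ ℚ)] :
    charRank G = freeGroupRank G := by
  have := finite_generators_of_finite_char (G := G)
  have := Fintype.ofFinite (IsFreeGroup.Generators G)
  rw [charRank, (charEquiv G).finrank_eq, freeGroupRank, Module.finrank_fintype_fun_eq_card,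
    Nat.card_eq_fintype_card]

theorem charRank_pos [Module.Finite ℚ (Additive G →+ ℚ)] [Nontrivial G] : 0 < charRank G := by
  have := finite_generators_of_finite_char (G := G)
  rw [charRank_eq_freeGroupRank, freeGroupRank, Nat.card_pos_iff]
  refine ⟨?_, this⟩
  by_contra hne
  rw [not_nonempty_iff] at hne
  obtain ⟨x, hx⟩ := exists_ne (1 : G)
  exact hx (DFunLike.congr_fun (IsFreeGroup.ext_hom (f := MonoidHom.id G) (g := 1)
    fun a => hne.elim a) x)

end FreeGroups

/-- In a free group of finite rank, a free factor family of nontrivial subgroups is finite. -/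
theorem IsFreeFactorFamily.finite {G ι : Type*} [Group G] [IsFreeGroup G]
    [Module.Finite ℚ (Additive G →+ ℚ)] {H : ι → Subgroup G} (hH : IsFreeFactorFamily H)
    (hne : ∀ i, H i ≠ ⊥) : Finite ι := by
  by_contra hinf
  rw [not_finite_iff_infinite] at hinf
  -- One factor more than the rank allows, as each nontrivial factor contributes at least 1.
  let e : Fin (charRank G + 1) → ι := fun k => Infinite.natEmbedding ι k
  have he : e.Injective := (Infinite.natEmbedding ι).injective.comp Fin.val_injective
  obtain ⟨B, hB⟩ := hH.comp_injective he
  have hsum := hB.charRank_eq_add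
  have hle : ∑ _k : Fin (charRank G + 1), 1 ≤ ∑ k, charRank (H (e k)) := by
    refine Finset.sum_le_sum fun k _ => ?_
    have : Module.Finite ℚ (Additive (H (e k)) →+ ℚ) := hB.finite_char (some k)
    have := (Subgroup.nontrivial_iff_ne_bot _).2 (hne (e k))
    exact charRank_pos
  simp only [Finset.sum_const, Finset.card_univ, Fintype.card_fin, smul_eq_mul, mul_one] at hle
  omega

/-! ### Complexity of free factor families -/

theorem Subgroup.mem_map_conj_iff {G : Type*} [Group G] {H : Subgroup G} {x g : G} :
    g ∈ H.map (MulAut.conj x).toMonoidHom ↔ x⁻¹ * g * x ∈ H := by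
  constructor
  · rintro ⟨h, hh, rfl⟩
    simpa [mul_assoc] using hh
  · intro h
    exact ⟨_, h, by simp [mul_assoc]⟩

/-- If the members of a free factor family `B` are conjugate into a subgroup `H`, then conjugates
of them form a free factor family of `H`. -/
theorem IsFreeFactorFamily.exists_conj_subgroupOf {G κ : Type*} [Group G] {B : κ → Subgroup G}
    (hB : IsFreeFactorFamily B) (H : Subgroup G)
    (hBH : ∀ k, ∃ x : G, B k ≤ H.map (MulAut.conj x).toMonoidHom) :
    ∃ y : κ → G, (∀ k, (B k).map (MulAut.conj (y k)).toMonoidHom ≤ H) ∧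
      IsFreeFactorFamily (fun k => ((B k).map (MulAut.conj (y k)).toMonoidHom).subgroupOf H) := by
  obtain ⟨C, hC⟩ := hB
  obtain ⟨I, γ, hfam, hcov⟩ := hC.kurosh H
  choose x hx using hBH
  -- The double coset of `(x k)⁻¹` singles out the Kurosh factor in which `B k` survives whole: its
  -- conjugate by `(x k)⁻¹` lies in `H`, and the correction `y k` is itself in `H`.
  choose i hi y hy b hb hxy using fun k => hcov (some k) (x k)⁻¹
  refine ⟨fun k => γ (i k), fun k g hg => ?_, ?_⟩
  · rw [Subgroup.mem_map_conj_iff] at hg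
    have h1 : (b k)⁻¹ * ((γ (i k))⁻¹ * g * γ (i k)) * b k ∈ B k :=
      mul_mem (mul_mem (inv_mem (hb k)) hg) (hb k)
    have h2 := Subgroup.mem_map_conj_iff.1 (hx k h1)
    have hxk : x k = (b k)⁻¹ * (γ (i k))⁻¹ * (y k)⁻¹ := by
      rw [← inv_inv (x k), hxy k]; group
    have h3 : g = (y k)⁻¹ * ((x k)⁻¹ * ((b k)⁻¹ * ((γ (i k))⁻¹ * g * γ (i k)) * b k) * x k) *
        y k := by
      rw [hxk]; group
    rw [h3]
    exact mul_mem (mul_mem (inv_mem (hy k)) h2) (hy k)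
  · have hinj : Function.Injective i := fun k k' h => by
      have := (hi k).symm.trans ((congrArg (fun i : I => i.1.1) h).trans (hi k'))
      exact Option.some_injective _ this
    have := hfam.comp_injective hinj
    simpa only [hi, Option.elim_some] using this

section Complexity

theorem IsFreeFactorFamily.finite_char {G ι : Type*} [Group G]
    [Module.Finite ℚ (Additive G →+ ℚ)] {H : ι → Subgroup G}
    (hH : IsFreeFactorFamily H) (i : ι) : Module.Finite ℚ (Additive (H i) →+ ℚ) :=
  hH.elim fun _ hB => hB.finite_char (some i)

variable {G : Type*} [Group G] [IsFreeGroup G] [Module.Finite ℚ (Additive G →+ ℚ)]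

theorem IsFreeFactorFamily.charRank_pos {ι : Type*} {H : ι → Subgroup G}
    (hH : IsFreeFactorFamily H) {i : ι} (hi : H i ≠ ⊥) : 0 < charRank (H i) := by
  have := hH.finite_char i
  have := (Subgroup.nontrivial_iff_ne_bot _).2 hi
  exact _root_.charRank_pos

/-- The complexity of a free factor family conjugate into `H` is at most that of `H`, with equality
only if `H` is conjugate to a member of the family. -/
theorem IsFreeFactorFamily.complexity_le {κ : Type*} [Fintype κ] {B : κ → Subgroup G}
    (hB : IsFreeFactorFamily B) (hBne : ∀ k, B k ≠ ⊥) {H : Subgroup G}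
    [Module.Finite ℚ (Additive H →+ ℚ)] (hH : H ≠ ⊥)
    (hBH : ∀ k, ∃ x : G, B k ≤ H.map (MulAut.conj x).toMonoidHom) :
    ∑ k, (2 * charRank (B k) - 1) ≤ 2 * charRank H - 1 ∧
      (∑ k, (2 * charRank (B k) - 1) = 2 * charRank H - 1 →
        ∃ k, ∃ x : G, H ≤ (B k).map (MulAut.conj x).toMonoidHom) := by
  obtain ⟨y, hy, D, hD⟩ := hB.exists_conj_subgroupOf H hBH
  have hrk (k : κ) : charRank (((B k).map (MulAut.conj (y k)).toMonoidHom).subgroupOf H) =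
      charRank (B k) :=
    (charRank_congr (Subgroup.subgroupOfEquivOfLe (hy k))).trans
      (charRank_congr ((B k).equivMapOfInjective _ (MulAut.conj (y k)).injective)).symm
  have hsum : charRank H = charRank D + ∑ k, charRank (B k) := by
    rw [hD.charRank_eq_add, Finset.sum_congr rfl fun k _ => hrk k]
  -- Positive ranks make the truncated subtractions honest. With `n` members, the complexity of `H`
  -- minus that of the family is thus `2 rank D + (n - 1)`, which vanishes only if `D` has rank 0
  -- and `n = 1`.
  have hcard : ∑ k, (2 * charRank (B k) - 1) + Fintype.card κ = 2 * ∑ k, charRank (B k) := by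
    rw [Finset.mul_sum, Fintype.card_eq_sum_ones, ← Finset.sum_add_distrib]
    refine Finset.sum_congr rfl fun k _ => ?_
    have := hB.charRank_pos (hBne k)
    omega
  have hpos : 0 < charRank H := by
    have := (Subgroup.nontrivial_iff_ne_bot _).2 hH
    exact _root_.charRank_pos
  constructor
  · rcases isEmpty_or_nonempty κ with h | h
    · simp
    · have := Fintype.card_pos (α := κ)
      omega
  · intro heq
    have hD0 : charRank D = 0 := by omega
    obtain ⟨k, hk⟩ := Fintype.card_eq_one_iff.1 (show Fintype.card κ = 1 by omega)
    have hDbot : D = ⊥ := by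
      by_contra hne
      have := (Subgroup.nontrivial_iff_ne_bot _).2 hne
      have : Module.Finite ℚ (Additive D →+ ℚ) := hD.finite_char none
      exact (_root_.charRank_pos (G := D)).ne' hD0
    refine ⟨k, y k, ?_⟩
    have htop := hD.1
    rw [iSup_option_elim, hDbot, bot_sup_eq] at htop
    rw [← Subgroup.subgroupOf_eq_top, eq_top_iff, ← htop]
    exact iSup_le fun k' => by rw [hk k']

/-- The complexity of a free factor family drops when the family is replaced by one that it
carries, unless the two families carry each other. -/
theorem IsFreeFactorFamily.complexity_lt_or_carries {ι κ : Type*} [Fintype ι] [Fintype κ]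
    {H : ι → Subgroup G} (hH : IsFreeFactorFamily H) (hHne : ∀ i, H i ≠ ⊥)
    {B : κ → Subgroup G} (hB : IsFreeFactorFamily B) (hBne : ∀ k, B k ≠ ⊥)
    (hBH : ∀ k, ∃ i, ∃ x : G, B k ≤ (H i).map (MulAut.conj x).toMonoidHom) :
    ∑ k, (2 * charRank (B k) - 1) < ∑ i, (2 * charRank (H i) - 1) ∨
      ∀ i, ∃ k, ∃ x : G, H i ≤ (B k).map (MulAut.conj x).toMonoidHom := by
  classical
  choose f hf using hBH
  have key (i : ι) := by
    have := hH.finite_char i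
    exact (hB.comp_injective (e := fun k : {k // f k = i} => (k : κ))
      Subtype.val_injective).complexity_le (fun k => hBne k) (hHne i)
      (by rintro ⟨k, rfl⟩; exact hf k)
  rw [← Fintype.sum_fiberwise f (fun k => 2 * charRank (B k) - 1)]
  by_cases h : ∀ i, ∑ k : {k // f k = i}, (2 * charRank (B k) - 1) = 2 * charRank (H i) - 1
  · right
    intro i
    obtain ⟨k, hk⟩ := (key i).2 (h i)
    exact ⟨k, hk⟩
  · left
    push Not at h
    obtain ⟨i, hi⟩ := h
    exact Finset.sum_lt_sum (fun i _ => (key i).1)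
      ⟨i, Finset.mem_univ i, lt_of_le_of_ne (key i).1 hi⟩

end Complexity

/-! ### Free factor systems and their pullbacks -/

/-- A free factor system with the trivial system written as the empty set. -/
def IsProperFreeFactorSystem {G : Type*} [Group G] (𝓕 : Set (Subgroup G)) : Prop :=
  (∀ H ∈ 𝓕, H ≠ ⊥) ∧ IsFreeFactorFamily (fun H : 𝓕 => (H : Subgroup G))

/-- The complexity `∑ (2 rank H - 1)` of a finite set of subgroups. -/
noncomputable def systemComplexity {G : Type*} [Group G] (𝓕 : Set (Subgroup G)) : ℕ :=
  ∑ᶠ H : 𝓕, (2 * charRank (H : Subgroup G) - 1)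

/-- Choosing one index per value makes injectivity of `H` unnecessary. -/
theorem IsFreeFactorFamily.isProperFreeFactorSystem_range {G ι : Type*} [Group G]
    {H : ι → Subgroup G} (hH : IsFreeFactorFamily H) (hne : ∀ i, H i ≠ ⊥) :
    IsProperFreeFactorSystem (Set.range H) := by
  refine ⟨Set.forall_mem_range.2 hne, ?_⟩
  simpa only [Set.apply_rangeSplitting] using
    hH.comp_injective (Set.rangeSplitting_injective H)

theorem isFreeFactorFamily_top {G : Type*} [Group G] :
    IsFreeFactorFamily (fun _ : Unit => (⊤ : Subgroup G)) := by
  refine ⟨⊥, by simp [iSup_option_elim], ?_⟩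
  let f : G →* (⊤ : Subgroup G) := (Subgroup.topEquiv (G := G)).symm.toMonoidHom
  refine ⟨(CoprodI.of (M := fun o : Option Unit => (o.elim ⊥ fun _ => ⊤ : Subgroup G))
    (i := some ())).comp f, ?_⟩
  rintro (_ | _) h
  · have h1 : h = 1 := Subsingleton.elim (α := (⊥ : Subgroup G)) _ _
    rw [h1]
    exact (map_one _).trans (map_one (CoprodI.of
      (M := fun o : Option Unit => (o.elim ⊥ fun _ => ⊤ : Subgroup G)) (i := none))).symm
  · rfl

theorem isProperFreeFactorSystem_singleton_top {G : Type*} [Group G] [Nontrivial G] :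
    IsProperFreeFactorSystem ({⊤} : Set (Subgroup G)) := by
  simpa using isFreeFactorFamily_top.isProperFreeFactorSystem_range fun _ => top_ne_bot

theorem systemComplexity_singleton_top {G : Type*} [Group G] :
    systemComplexity ({⊤} : Set (Subgroup G)) = 2 * charRank G - 1 := by
  rw [systemComplexity, finsum_eq_sum_of_fintype, Fintype.sum_unique,
    ← charRank_congr (Subgroup.topEquiv (G := G))]
  rfl

/-- A free factor of a group with finitely many independent characters has the same property. -/
theorem IsFreeFactor.finite_char {G : Type*} [Group G] [Module.Finite ℚ (Additive G →+ ℚ)]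
    {A : Subgroup G} (hA : IsFreeFactor A) : Module.Finite ℚ (Additive A →+ ℚ) := by
  have h := ((isFreeFactorFamily_top (G := A)).map_subtype hA).finite_char ()
  rwa [← MonoidHom.range_eq_map, Subgroup.range_subtype] at h

theorem IsProperFreeFactorSystem.isFreeFactorSystem {G : Type*} [Group G] [IsFreeGroup G]
    [Module.Finite ℚ (Additive G →+ ℚ)] {𝓕 : Set (Subgroup G)} (h𝓕 : IsProperFreeFactorSystem 𝓕)
    (hne : 𝓕.Nonempty) : IsFreeFactorSystem 𝓕 :=
  Or.inr ⟨hne, h𝓕.2.finite fun H => h𝓕.1 H H.2, h𝓕.1, (isFreeFactorFamily_iff _).1 h𝓕.2⟩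

theorem Carries.trans {G : Type*} [Group G] {𝒜 ℬ 𝒞 : Set (Subgroup G)} (h₁ : Carries 𝒜 ℬ)
    (h₂ : Carries ℬ 𝒞) : Carries 𝒜 𝒞 := by
  intro C hC
  obtain ⟨B, hB, x, hx⟩ := h₂ C hC
  obtain ⟨A, hA, y, hy⟩ := h₁ B hB
  refine ⟨A, hA, x * y, hx.trans fun g hg => ?_⟩
  rw [Subgroup.mem_map_conj_iff] at hg ⊢
  have := Subgroup.mem_map_conj_iff.1 (hy hg)
  simpa [mul_assoc] using this

theorem Carries.map {G G' : Type*} [Group G] [Group G'] (f : G →* G') {𝒜 ℬ : Set (Subgroup G)}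
    (h : Carries 𝒜 ℬ) :
    Carries ((fun H : Subgroup G => H.map f) '' 𝒜) ((fun H : Subgroup G => H.map f) '' ℬ) := by
  rintro _ ⟨B, hB, rfl⟩
  obtain ⟨A, hA, x, hx⟩ := h B hB
  refine ⟨_, ⟨A, hA, rfl⟩, f x, ?_⟩
  rintro _ ⟨b, hb, rfl⟩
  rw [Subgroup.mem_map_conj_iff]
  exact ⟨x⁻¹ * b * x, Subgroup.mem_map_conj_iff.1 (hx hb), by simp⟩

theorem IsProperFreeFactorSystem.complexity_lt_or_carries {G : Type*} [Group G] [IsFreeGroup G]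
    [Module.Finite ℚ (Additive G →+ ℚ)] {𝓕 𝓖 : Set (Subgroup G)}
    (h𝓕 : IsProperFreeFactorSystem 𝓕) (h𝓖 : IsProperFreeFactorSystem 𝓖) (h : Carries 𝓕 𝓖) :
    systemComplexity 𝓖 < systemComplexity 𝓕 ∨ Carries 𝓖 𝓕 := by
  have := h𝓕.2.finite fun H => h𝓕.1 H H.2
  have := h𝓖.2.finite fun H => h𝓖.1 H H.2
  have := Fintype.ofFinite 𝓕
  have := Fintype.ofFinite 𝓖
  rw [systemComplexity, systemComplexity, finsum_eq_sum_of_fintype, finsum_eq_sum_of_fintype]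
  refine (h𝓕.2.complexity_lt_or_carries (fun H => h𝓕.1 H H.2) h𝓖.2 (fun H => h𝓖.1 H H.2)
    fun B => ?_).imp_right fun h' H hH => ?_
  · obtain ⟨A, hA, x, hx⟩ := h B B.2
    exact ⟨⟨A, hA⟩, x, hx⟩
  · obtain ⟨B, x, hx⟩ := h' ⟨H, hH⟩
    exact ⟨B, B.2, x, hx⟩

/-- The pullback of a free factor family along an injective homomorphism: the nontrivial preimages
of conjugates of its members. -/
theorem IsFreeFactorFamily.exists_pullback {F K ι : Type*} [Group F] [Group K]
    {H : ι → Subgroup F} (hH : IsFreeFactorFamily H) {φ : K →* F} (hφ : Function.Injective φ) :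
    ∃ 𝓖 : Set (Subgroup K), IsProperFreeFactorSystem 𝓖 ∧
      (∀ G ∈ 𝓖, ∃ i, ∃ x : F, G.map φ ≤ (H i).map (MulAut.conj x).toMonoidHom) ∧
      ∀ C : Subgroup K, C ≠ ⊥ →
        (∃ i, ∃ x : F, C.map φ ≤ (H i).map (MulAut.conj x).toMonoidHom) →
        ∃ G ∈ 𝓖, ∃ a : K, C ≤ G.map (MulAut.conj a).toMonoidHom := by
  obtain ⟨B, hB⟩ := hH
  obtain ⟨I, γ, hfam, hcov⟩ := hB.kurosh φ.range
  let P (i : I) : Subgroup K :=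
    ((i.1.1.elim B H).map (MulAut.conj (γ i)).toMonoidHom).comap φ
  have hP : IsFreeFactorFamily P := by
    convert hfam.map_mulEquiv (MonoidHom.ofInjective hφ).symm using 2 with i
    ext k
    simp only [P, Subgroup.mem_comap]
    constructor
    · intro hk
      exact ⟨MonoidHom.ofInjective hφ k, hk, (MonoidHom.ofInjective hφ).symm_apply_apply k⟩
    · rintro ⟨k', hk', rfl⟩
      have : φ ((MonoidHom.ofInjective hφ).symm k') = k' := MonoidHom.apply_ofInjective_symm hφ k'
      exact (congrArg (· ∈ _) this).mpr hk'
  -- Kurosh factors coming from the complement `B` are dropped, as are the trivial ones.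
  let I' := {i : I // (∃ k, i.1.1 = some k) ∧ P i ≠ ⊥}
  refine ⟨Set.range fun i : I' => P i, (hP.comp_injective (e := fun i : I' => i.1)
    Subtype.val_injective).isProperFreeFactorSystem_range fun i => i.2.2, ?_, ?_⟩
  · rintro _ ⟨⟨i, ⟨k, hk⟩, -⟩, rfl⟩
    refine ⟨k, γ i, Subgroup.map_le_iff_le_comap.2 ?_⟩
    simp only [P, hk, Option.elim_some, le_refl]
  · rintro C hC ⟨k, x, hx⟩
    -- Writing `x = φ a * γ i * h`, the factor `h` normalizes `H k` and `φ a` comes from a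
    -- conjugation in `K`.
    obtain ⟨i, hi, _, ⟨a, rfl⟩, h, hh, rfl⟩ := hcov (some k) x
    have hle : C ≤ (P i).map (MulAut.conj a).toMonoidHom := by
      intro c hc
      have h1 := Subgroup.mem_map_conj_iff.1 (hx ⟨c, hc, rfl⟩)
      have h2 : (γ i)⁻¹ * φ (a⁻¹ * c * a) * γ i ∈ H k := by
        have := mul_mem (mul_mem hh h1) (inv_mem hh)
        simpa [mul_assoc] using this
      rw [Subgroup.mem_map_conj_iff]
      simp only [P, hi, Option.elim_some, Subgroup.mem_comap]
      exact Subgroup.mem_map_conj_iff.2 h2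
    refine ⟨P i, ⟨⟨i, ⟨k, hi⟩, fun hbot => hC ?_⟩, rfl⟩, a, hle⟩
    rw [hbot, Subgroup.map_bot] at hle
    exact le_bot_iff.1 hle

/-! ### Forward iterates and iterated pullbacks -/

section ForwardIterates

variable {F : Type*} [Group F] {A : Subgroup F} {φ : A →* F}

/-- The pullback of a free factor system of `A` along an injective homomorphism `A → F`. -/
theorem IsProperFreeFactorSystem.exists_pullback (hA : IsFreeFactor A)
    (hφ : Function.Injective φ) {𝓕 : Set (Subgroup A)} (h𝓕 : IsProperFreeFactorSystem 𝓕) :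
    ∃ 𝓖 : Set (Subgroup A), IsProperFreeFactorSystem 𝓖 ∧
      Carries (inAmbient 𝓕) ((fun H : Subgroup A => H.map φ) '' 𝓖) ∧
      ∀ ℬ : Set (Subgroup A), (∀ B ∈ ℬ, B ≠ ⊥) →
        Carries (inAmbient 𝓕) ((fun H : Subgroup A => H.map φ) '' ℬ) → Carries 𝓖 ℬ := by
  obtain ⟨𝓖, h𝓖, h1, h2⟩ := (h𝓕.2.map_subtype hA).exists_pullback hφ
  refine ⟨𝓖, h𝓖, ?_, fun ℬ hℬ hc B hB => h2 B (hℬ B hB) ?_⟩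
  · rintro _ ⟨G, hG, rfl⟩
    obtain ⟨i, x, hx⟩ := h1 G hG
    exact ⟨_, ⟨i, i.2, rfl⟩, x, hx⟩
  · obtain ⟨_, ⟨H, hH, rfl⟩, x, hx⟩ := hc _ ⟨B, hB, rfl⟩
    exact ⟨⟨H, hH⟩, x, hx⟩

theorem HasForwardIterates.mono {m n : ℕ} (hmn : m ≤ n) {c : ConjClasses F}
    (h : HasForwardIterates φ n c) : HasForwardIterates φ m c := by
  induction n, hmn using Nat.le_induction with
  | base => exact h
  | succ n _ ih =>
    obtain ⟨_, hd⟩ := h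
    cases hd with
    | succ _ _ a h => exact ih ⟨_, h⟩

/-- If `𝓕 (n + 1)` carries everything that `φ` maps into `𝓕 n`, then a class with `n + 1` forward
iterates is trivial or carried by `𝓕 n`. -/
theorem HasForwardIterates.carriesClass (hφ : Function.Injective φ) {𝓕 : ℕ → Set (Subgroup A)}
    (h0 : ⊤ ∈ 𝓕 0)
    (h𝓕 : ∀ n, ∀ ℬ : Set (Subgroup A), (∀ B ∈ ℬ, B ≠ ⊥) →
      Carries (inAmbient (𝓕 n)) ((fun H : Subgroup A => H.map φ) '' ℬ) → Carries (𝓕 (n + 1)) ℬ)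
    {n : ℕ} {c : ConjClasses F} (h : HasForwardIterates φ (n + 1) c) :
    c = ConjClasses.mk 1 ∨ CarriesClass (inAmbient (𝓕 n)) c := by
  -- Quantifying over `m` lets the induction run backwards: if `φ a` is conjugate into `𝓕 m`, then
  -- `a` is conjugate into `𝓕 (m + 1)`. The trivial class is kept apart because the pullback
  -- property, applied to the cyclic group of `a`, needs a nontrivial subgroup.
  have key {n : ℕ} {c d : ConjClasses F} (h : IsForwardIterate φ n c d) : ∀ m,
      (d = ConjClasses.mk 1 ∨ CarriesClass (inAmbient (𝓕 m)) d) →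
      (c = ConjClasses.mk 1 ∨ CarriesClass (inAmbient (𝓕 (m + n))) c) := by
    induction h with
    | zero c => exact fun m h => h
    | succ n c a h ih =>
      intro m hm
      rw [show m + (n + 1) = m + 1 + n by omega]
      refine ih (m + 1) ?_
      by_cases ha : a = 1
      · exact Or.inl (by rw [ha]; rfl)
      right
      rcases hm with hm | ⟨_, ⟨H, hH, rfl⟩, k, hk, hm⟩
      · rw [ConjClasses.mk_eq_mk_iff_isConj, isConj_one_left] at hm
        exact absurd (hφ (hm.trans (map_one φ).symm)) ha
      · rw [ConjClasses.mk_eq_mk_iff_isConj, isConj_iff] at hm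
        obtain ⟨x, hx⟩ := hm
        obtain ⟨G, hG, y, hy⟩ := h𝓕 m {Subgroup.zpowers a} (by simpa using ha) (by
          rintro _ ⟨_, rfl, rfl⟩
          refine ⟨_, ⟨H, hH, rfl⟩, x, ?_⟩
          beta_reduce
          rw [MonoidHom.map_zpowers, Subgroup.zpowers_le]
          exact ⟨k, hk, hx⟩) _ rfl
        have hya := Subgroup.mem_map_conj_iff.1 (hy (Subgroup.mem_zpowers a))
        refine ⟨_, ⟨G, hG, rfl⟩, _, ⟨_, hya, rfl⟩, ?_⟩
        rw [ConjClasses.mk_eq_mk_iff_isConj, isConj_iff]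
        exact ⟨y, by simp [mul_assoc]⟩
  obtain ⟨_, hd⟩ := h
  cases hd with
  | succ _ _ a h =>
    -- The last of the `n + 1` iterates only certifies that the `n`-th one meets `A`, hence is
    -- carried by `𝓕 0`.
    have := key h 0 (Or.inr ⟨_, ⟨⊤, h0, rfl⟩, a, ⟨a, trivial, rfl⟩, rfl⟩)
    rwa [zero_add] at this

end ForwardIterates

/-! ### Stabilization of the chain and the theorem -/

theorem exists_lt_of_forall_lt_or {P : ℕ → Prop} {κ : ℕ → ℕ} (h : ∀ n, κ (n + 1) < κ n ∨ P n)
    {N : ℕ} (hN : κ 0 < N) : ∃ n < N, P n := by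
  by_contra! hP
  have (n : ℕ) : n ≤ N → κ n + n ≤ κ 0 := by
    induction n with
    | zero => simp
    | succ n ih =>
      intro hn
      have h1 := ih (by omega)
      have h2 := (h n).resolve_right (hP n (by omega))
      omega
  have := this N le_rfl
  omega

theorem mainTheorem11 {F : Type*} [Group F] [IsFreeGroup F]
    [Finite (IsFreeGroup.Generators F)] (A : Subgroup F) (hA : IsFreeFactor A) (hA_ne : A ≠ ⊥)
    (φ : A →* F) (hφ : Function.Injective φ) :
    ∃ 𝓕 : Set (Subgroup A),
      IsMaximalInvariantFreeFactorSystem φ 𝓕 ∧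
      (∀ 𝓖 : Set (Subgroup A), IsMaximalInvariantFreeFactorSystem φ 𝓖 →
        Carries 𝓕 𝓖 ∧ Carries 𝓖 𝓕) ∧
      (∀ c : ConjClasses F, HasForwardIterates φ (2 * freeGroupRank A) c →
        CarriesClass (inAmbient 𝓕) c) ∧
      (∀ ℬ : Set (Subgroup A), IsSubgroupSystem ℬ → IsInvariantSystem φ ℬ →
        Carries 𝓕 ℬ) := by
  have := finite_char_of_finite_generators (G := F)
  have := hA.finite_char
  have := (Subgroup.nontrivial_iff_ne_bot A).2 hA_ne
  -- the iterated pullbacks of `{A}`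
  choose s hs hs1 hs2 using fun 𝓕 : {𝓕 : Set (Subgroup A) // IsProperFreeFactorSystem 𝓕} =>
    𝓕.2.exists_pullback hA hφ
  let 𝓢 : ℕ → {𝓕 : Set (Subgroup A) // IsProperFreeFactorSystem 𝓕} := fun n =>
    (fun 𝓕 => ⟨s 𝓕, hs 𝓕⟩)^[n] ⟨{⊤}, isProperFreeFactorSystem_singleton_top⟩
  have h𝓢 (n : ℕ) : (𝓢 (n + 1)).1 = s (𝓢 n) := by
    simp only [𝓢, Function.iterate_succ_apply']
  have hpush (n : ℕ) : Carries (inAmbient (𝓢 n).1)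
      ((fun H : Subgroup A => H.map φ) '' (𝓢 (n + 1)).1) := by
    rw [h𝓢]; exact hs1 _
  have hpull (n : ℕ) (ℬ : Set (Subgroup A)) (hℬ : ∀ B ∈ ℬ, B ≠ ⊥)
      (h : Carries (inAmbient (𝓢 n).1) ((fun H : Subgroup A => H.map φ) '' ℬ)) :
      Carries (𝓢 (n + 1)).1 ℬ := by
    rw [h𝓢]; exact hs2 _ ℬ hℬ h
  have hzero (ℬ : Set (Subgroup A)) : Carries (𝓢 0).1 ℬ := fun B _ =>
    ⟨⊤, rfl, 1, fun b _ => ⟨b, trivial, by simp⟩⟩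
  have hmono (n : ℕ) : Carries (𝓢 n).1 (𝓢 (n + 1)).1 := by
    induction n with
    | zero => exact hzero _
    -- `φ` maps `𝓢 (n + 2)` into `𝓢 (n + 1)`, which `𝓢 n` carries by induction.
    | succ n ih => exact hpull n _ (𝓢 (n + 2)).2.1 ((ih.map A.subtype).trans (hpush (n + 1)))
  have hcarry (ℬ : Set (Subgroup A)) (hℬ : ∀ B ∈ ℬ, B ≠ ⊥) (hinv : IsInvariantSystem φ ℬ)
      (n : ℕ) : Carries (𝓢 n).1 ℬ := by
    induction n with
    | zero => exact hzero _
    | succ n ih => exact hpull n _ hℬ ((ih.map A.subtype).trans hinv)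
  obtain ⟨n, hn, hstab⟩ : ∃ n < 2 * freeGroupRank A, Carries (𝓢 (n + 1)).1 (𝓢 n).1 := by
    refine exists_lt_of_forall_lt_or (κ := fun n => systemComplexity (𝓢 n).1)
      (fun n => (𝓢 n).2.complexity_lt_or_carries (𝓢 (n + 1)).2 (hmono n)) ?_
    change systemComplexity {⊤} < _
    rw [systemComplexity_singleton_top, charRank_eq_freeGroupRank]
    -- Positivity of the rank is what makes the truncated `2 rank A - 1` smaller than `2 rank A`.
    have := charRank_pos (G := A)
    rw [charRank_eq_freeGroupRank] at this
    omega
  have hinv : IsInvariantSystem φ (𝓢 n).1 := (hpush n).trans (hstab.map φ)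
  -- the empty system is replaced by the trivial one
  obtain ⟨𝓕, hsub, hmem, hne, hffs⟩ : ∃ 𝓕 : Set (Subgroup A), (𝓢 n).1 ⊆ 𝓕 ∧
      (∀ H ∈ 𝓕, H = ⊥ ∨ H ∈ (𝓢 n).1) ∧ 𝓕.Nonempty ∧ IsFreeFactorSystem 𝓕 := by
    rcases (𝓢 n).1.eq_empty_or_nonempty with h | h
    · exact ⟨{⊥}, by simp [h], by simp, by simp, Or.inl rfl⟩
    · exact ⟨_, subset_rfl, fun H hH => Or.inr hH, h, (𝓢 n).2.isFreeFactorSystem h⟩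
  obtain ⟨H₀, hH₀⟩ := hne
  have hall (ℬ : Set (Subgroup A)) (hℬ : IsSubgroupSystem ℬ) (hinv : IsInvariantSystem φ ℬ) :
      Carries 𝓕 ℬ := by
    rcases hℬ with rfl | ⟨-, -, hℬ⟩
    · rintro _ rfl
      exact ⟨H₀, hH₀, 1, bot_le⟩
    · intro B hB
      obtain ⟨H, hH, hx⟩ := hcarry ℬ hℬ hinv n B hB
      exact ⟨H, hsub hH, hx⟩
  have hsys {ℬ : Set (Subgroup A)} (hℬ : IsFreeFactorSystem ℬ) : IsSubgroupSystem ℬ :=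
    hℬ.imp_right fun h => ⟨h.1, h.2.1, h.2.2.1⟩
  have hinv𝓕 : IsInvariantSystem φ 𝓕 := by
    rintro _ ⟨H, hH, rfl⟩
    rcases hmem H hH with rfl | hH'
    · exact ⟨_, ⟨H₀, hH₀, rfl⟩, 1, by simp⟩
    · obtain ⟨_, ⟨G, hG, rfl⟩, hx⟩ := hinv _ ⟨H, hH', rfl⟩
      exact ⟨_, ⟨G, hsub hG, rfl⟩, hx⟩
  refine ⟨𝓕, ⟨hffs, hinv𝓕, fun ℬ hℬ hi _ => hall ℬ (hsys hℬ) hi⟩, fun 𝓖 h𝓖 => ?_,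
    fun c hc => ?_, hall⟩
  · have h := hall 𝓖 (hsys h𝓖.1) h𝓖.2.1
    -- `𝓕` carries every invariant system, so maximality of `𝓖` gives the reverse relation.
    exact ⟨h, h𝓖.2.2 𝓕 hffs hinv𝓕 h⟩
  -- Here `n < 2 rank A` is read as `n + 1 ≤ 2 rank A`, which supplies the `n + 1` iterates needed
  -- for `𝓢 n`.
  · rcases (hc.mono hn).carriesClass hφ (𝓕 := fun n => (𝓢 n).1) rfl hpull with rfl | h
    · exact ⟨_, ⟨H₀, hH₀, rfl⟩, 1, one_mem _, rfl⟩
    · obtain ⟨_, ⟨H, hH, rfl⟩, hx⟩ := h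
      exact ⟨_, ⟨H, hsub hH, rfl⟩, hx⟩
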